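/- **Theorem.** A $3$-graph is a $3$-uniform hypergraph. The degree of a vertex is the number of edges containing it, and $\delta_1(G)$ denotes the minimum vertex degree of $G$. For a $3$-graph $F$, a $3$-graph $G$ has an $F$-covering if every vertex of $G$ is contained in a copy of $F$ in $G$ (a not necessarily induced subgraph isomorphic to $F$). Let $$c_1(n,F)=\max\{\delta_1(G): G \text{ is a } 3\text{-graph on } n \text{ vertices with no } F\text{-covering}\},\qquad c_1(F)=\lim_{n\to\infty} \frac{c_1(n,F)}{\binom{n-1}{2}}.$$ Let $C_5^{(3)}$ be the tight $5$-cycle: the $3$-graph with vertex set $\mathbb{Z}/5\mathbb{Z}$ and edges $\{i,i+1,i+2\}$ for $i\in\mathbb{Z}/5\mathbb{Z}$. Then the limit $c_1(C_5^{(3)})$ exists, and $$\frac{5}{9}\le c_1(C_5^{(3)})\le 2-\sqrt{2}.$$ -/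

import Mathlib

open Filter Topology

noncomputable section

namespace Hypergraph

/-- `G` is `r`-uniform (an `r`-graph): each edge consists of exactly `r` vertices. -/
def IsUniform {α : Type*} (G : Hypergraph α) (r : ℕ) : Prop :=
  ∀ e ∈ G.edgeSet, e.encard = r

/-- The neighbourhood of `S`: the sets `T`, disjoint from `S`, such that `S ∪ T` is an edge. -/
def neighborhood {α : Type*} (G : Hypergraph α) (S : Set α) : Set (Set α) :=
  {T | Disjoint S T ∧ S ∪ T ∈ G.edgeSet}

/-- The degree of `S`: the size of its neighbourhood. -/
def degree {α : Type*} (G : Hypergraph α) (S : Set α) : ℕ :=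
  (G.neighborhood S).ncard

/-- The minimum `i`-degree: the minimum of the degrees of all `i`-subsets of the vertex set. -/
def minDegree {α : Type*} (i : ℕ) (G : Hypergraph α) : ℕ :=
  sInf {d | ∃ S ⊆ G.vertexSet, S.encard = i ∧ G.degree S = d}

/-- The map `f`, restricted to the vertices of `F`, embeds `F` into `G` as a (not necessarily
induced) subgraph. Its image is a copy of `F` in `G`, with vertex set `f '' F.vertexSet`. -/
def IsCopy {α β : Type*} (F : Hypergraph β) (G : Hypergraph α) (f : β → α) : Prop :=
  Set.InjOn f F.vertexSet ∧ Set.MapsTo f F.vertexSet G.vertexSet ∧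
    ∀ e ∈ F.edgeSet, f '' e ∈ G.edgeSet

/-- `G` has an `F`-covering: every vertex of `G` is contained in a copy of `F` in `G`. -/
def HasCovering {α β : Type*} (F : Hypergraph β) (G : Hypergraph α) : Prop :=
  ∀ v ∈ G.vertexSet, ∃ f : β → α, IsCopy F G f ∧ v ∈ f '' F.vertexSet

/-- The `i`-degree `F`-covering threshold `c_i(n, F)` of an `r`-graph `F`: the maximum of the
minimum `i`-degree over all `n`-vertex `r`-graphs without an `F`-covering. -/
def coveringThreshold {β : Type*} (r i n : ℕ) (F : Hypergraph β) : ℕ :=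
  sSup {d | ∃ G : Hypergraph (Fin n),
    G.vertexSet = Set.univ ∧ G.IsUniform r ∧ ¬ HasCovering F G ∧ G.minDegree i = d}

/-- The ratio `c_i(n, F) / binom(n - i, r - i)`, for an `r`-graph `F`. -/
def coveringRatio {β : Type*} (r i : ℕ) (F : Hypergraph β) (n : ℕ) : ℝ :=
  (coveringThreshold r i n F : ℝ) / ((n - i).choose (r - i) : ℝ)

/-- The `i`-degree `F`-covering density `c_i(F)` of an `r`-graph `F`: the limit of
`c_i(n, F) / binom(n - i, r - i)` as `n` tends to infinity. -/
def coveringDensity {β : Type*} (r i : ℕ) (F : Hypergraph β) : ℝ :=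
  limUnder atTop (coveringRatio r i F)

/-- The tight `r`-uniform `t`-cycle `C_t^{(r)}` (for `t ≥ r`): its vertices are the integers
modulo `t`, and its edges are the sets of `r` cyclically consecutive vertices. -/
def tightCycle (r t : ℕ) : Hypergraph (ZMod t) where
  vertexSet := Set.univ
  edgeSet := {e | ∃ i : ZMod t, e = (fun j : ℕ => i + (j : ZMod t)) '' Set.Iio r}
  subset_vertexSet_of_mem_edgeSet' := fun _ _ => Set.subset_univ _

end Hypergraph

end

/-! Each pair of vertices of `C_5^{(3)}` lies in an edge, so every homomorphism from it into a
`3`-graph is injective. Hence a blow-up of a `3`-graph `G` contains a copy of `C_5^{(3)}` at a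
vertex only if `G` does at the image of that vertex. Blow-ups therefore preserve the absence of a
covering, `c_1(n, F) / n ^ 2` is nondecreasing along multiples, and the limit exists.

Upper bound. Let `v` lie in no copy, let `p` have the largest degree `a` in the link of `v`, and let
`A` be the set of `q` such that `v p q` is an edge. A vertex `q ∈ A` together with `r s` common to
the links of `v` and `p`, `q r` in the link of `v` and `s q` in the link of `p`, would give the
cycle `v r s p q`. Excluding this for all `q ∈ A` bounds the total degree of the two links:
`4 δ_1 ≤ n ^ 2 + (n - a) ^ 2`. Since also `2 δ_1 ≤ n a`, it follows that `2 δ_1 ≤ (2 - √2) n ^ 2`.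

Lower bound. Colour the vertices other than `v` in the ratio `2 : 1`; take the triples through `v`
whose other two vertices have the same colour, and the triples avoiding `v` with both colours. In a
tight cycle through `v` the other four vertices would get one colour, but three of them form an
edge.
-/

namespace HypergraphCovering

open Hypergraph

section Hypergraph

variable {α β : Type*} {G : Hypergraph α} {F : Hypergraph β} {i k r n : ℕ}

lemma encard_of_mem_neighborhood (hG : G.IsUniform (k + i)) {S T : Set α} (hS : S.encard = i)
    (hT : T ∈ G.neighborhood S) : T.encard = k := by
  have h : S.encard + T.encard = k + i := by
    rw [← Set.encard_union_eq hT.1, hG _ hT.2, Nat.cast_add]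
  rw [hS, add_comm] at h
  exact WithTop.add_right_cancel (ENat.natCast_ne_top i) h

lemma exists_injective_range_eq {T : Set α} (hT : T.encard = k) :
    ∃ e : Fin k → α, e.Injective ∧ Set.range e = T := by
  have : Finite T := Set.finite_of_encard_eq_coe hT
  have hcard : Nat.card T = k := by
    rw [Nat.card_coe_set_eq, Set.ncard_def, hT, ENat.toNat_natCast]
  let e := (Finite.equivFinOfCardEq hcard).symm
  exact ⟨(↑) ∘ e, Subtype.val_injective.comp e.injective, by simp [Set.range_comp]⟩

lemma minDegree_one_le_degree {u : α} (hu : u ∈ V(G)) : G.minDegree 1 ≤ G.degree {u} :=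
  Nat.sInf_le ⟨{u}, by simpa using hu, by simp, rfl⟩

lemma le_minDegree_one (hV : V(G).Nonempty) {d : ℕ} (h : ∀ u ∈ V(G), d ≤ G.degree {u}) :
    d ≤ G.minDegree 1 := by
  obtain ⟨u, hu⟩ := hV
  refine le_csInf ⟨_, {u}, by simpa using hu, by simp, rfl⟩ ?_
  rintro _ ⟨S, hSV, hS, rfl⟩
  obtain ⟨w, rfl⟩ := Set.encard_eq_one.1 (by simpa using hS)
  exact h w (hSV rfl)

lemma minDegree_le_card_pow [Finite α] (hG : G.IsUniform (k + i)) :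
    G.minDegree i ≤ Nat.card α ^ k := by
  obtain h | h := Nat.eq_zero_or_pos (G.minDegree i)
  · omega
  obtain ⟨S, -, hS, hdeg⟩ := Nat.sInf_mem (Nat.nonempty_of_pos_sInf h)
  have hsub : G.neighborhood S ⊆ Set.range (Set.range : (Fin k → α) → Set α) := fun T hT =>
    (exists_injective_range_eq (encard_of_mem_neighborhood hG hS hT)).imp fun _ he => he.2
  calc G.minDegree i = (G.neighborhood S).ncard := hdeg.symm
    _ ≤ (Set.range (Set.range : (Fin k → α) → Set α)).ncard := Set.ncard_le_ncard hsub
    _ ≤ Nat.card (Fin k → α) := by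
      rw [← Set.image_univ, ← Set.ncard_univ]
      exact Set.ncard_image_le
    _ = Nat.card α ^ k := by rw [Nat.card_fun, Nat.card_fin]

lemma minDegree_le_coveringThreshold {G : Hypergraph (Fin n)} (hV : V(G) = Set.univ)
    (hG : G.IsUniform r) (hc : ¬ HasCovering F G) :
    G.minDegree i ≤ coveringThreshold r i n F := by
  have : Finite (Hypergraph (Fin n)) :=
    Finite.of_injective (fun H => (V(H), E(H))) fun H H' h => by
      cases H; cases H'; simpa using h
  have hfin := Set.finite_range (minDegree (α := Fin n) i)
  refine le_csSup (hfin.subset ?_).bddAbove ⟨G, hV, hG, hc, rfl⟩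
  rintro _ ⟨G, -, -, -, rfl⟩
  exact Set.mem_range_self G

lemma coveringThreshold_le {d : ℕ} (h : ∀ G : Hypergraph (Fin n), V(G) = Set.univ →
    G.IsUniform r → ¬ HasCovering F G → G.minDegree i ≤ d) : coveringThreshold r i n F ≤ d := by
  refine csSup_le' ?_
  rintro _ ⟨G, hV, hG, hc, rfl⟩
  exact h G hV hG hc

lemma coveringThreshold_le_pow : coveringThreshold (k + i) i n F ≤ n ^ k :=
  coveringThreshold_le fun G _ hG _ => by simpa using minDegree_le_card_pow hG

lemma not_hasCovering_iff :
    ¬ HasCovering F G ↔ ∃ v ∈ V(G), ∀ f, IsCopy F G f → v ∉ f '' V(F) := by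
  simp only [HasCovering]
  push Not
  rfl

/-- Every homomorphism from `F` is injective, because no edge can be collapsed. -/
lemma isCopy_of_image_mem_edgeSet (hF : F.IsUniform r) (hadj : V(F).Pairwise F.Adj)
    (hG : G.IsUniform r) (hV : V(G) = Set.univ) {f : β → α} (hf : ∀ e ∈ E(F), f '' e ∈ E(G)) :
    IsCopy F G f := by
  refine ⟨fun x hx y hy hxy => ?_, fun _ _ => hV ▸ Set.mem_univ _, hf⟩
  by_contra hne
  obtain ⟨e, he, hxe, hye⟩ := hadj hx hy hne
  have hinj : Set.InjOn f e := (Set.finite_of_encard_eq_coe (hF e he)).injOn_of_encard_image_eq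
    ((hG _ (hf e he)).trans (hF e he).symm)
  exact hne (hinj hxe hye hxy)

end Hypergraph

section Blowup

variable {α β γ ι : Type*} {G : Hypergraph α} {F : Hypergraph γ} {k r : ℕ} {f : β → α}

/-- The blow-up of an `r`-graph `G` in which each vertex `x` is replaced by the fibre of `f`
over `x`: its edges are the `r`-sets mapped by `f` onto an edge of `G`. -/
def blowup (r : ℕ) (G : Hypergraph α) (f : β → α) : Hypergraph β where
  vertexSet := Set.univ
  edgeSet := {e | e.encard = r ∧ f '' e ∈ E(G)}
  subset_vertexSet_of_mem_edgeSet' := fun _ _ => Set.subset_univ _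

lemma isUniform_blowup : (blowup r G f).IsUniform r := fun _ he => he.1

lemma not_hasCovering_blowup (hF : F.IsUniform r) (hadj : V(F).Pairwise F.Adj)
    (hG : G.IsUniform r) (hV : V(G) = Set.univ) (hf : f.Surjective) (hc : ¬ HasCovering F G) :
    ¬ HasCovering F (blowup r G f) := by
  obtain ⟨v, -, hv⟩ := not_hasCovering_iff.1 hc
  obtain ⟨w, rfl⟩ := hf v
  refine not_hasCovering_iff.2 ⟨w, Set.mem_univ w, fun g hg hw => hv (f ∘ g) ?_ ?_⟩
  · refine isCopy_of_image_mem_edgeSet hF hadj hG hV fun e he => ?_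
    rw [Set.image_comp]
    exact (hg.2.2 e he).2
  · rw [Set.image_comp]
    exact Set.mem_image_of_mem f hw

lemma range_mem_neighborhood_blowup {u : β} {e : Fin k → α}
    {s : Fin k → β} (he : e.Injective) (hT : Set.range e ∈ G.neighborhood {f u})
    (hs : ∀ j, f (s j) = e j) : Set.range s ∈ (blowup (k + 1) G f).neighborhood {u} := by
  have himage : f '' Set.range s = Set.range e := by
    rw [← Set.range_comp]
    exact congrArg Set.range (funext hs)
  have hus : u ∉ Set.range s := fun h =>
    Set.disjoint_singleton_left.1 hT.1 (himage ▸ Set.mem_image_of_mem f h)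
  have hinj : s.Injective := Function.Injective.of_comp (f := f) ((funext hs : f ∘ s = e) ▸ he)
  refine ⟨Set.disjoint_singleton_left.2 hus, ?_, ?_⟩
  · rw [Set.singleton_union, Set.encard_insert_of_notMem hus, ← Set.image_univ,
      hinj.encard_image, Set.encard_univ]
    simp
  · rw [Set.image_union, Set.image_singleton, himage]
    exact hT.2

lemma degree_mul_pow_le_degree_blowup [Finite β] (hG : G.IsUniform (k + 1))
    {g : α × ι → β} (hg : g.Injective) (hfg : ∀ p, f (g p) = p.1) (u : β) :
    G.degree {f u} * Nat.card ι ^ k ≤ (blowup (k + 1) G f).degree {u} := by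
  have : Nonempty α := ⟨f u⟩
  choose! e heinj hrange using fun T (hT : T ∈ G.neighborhood {f u}) =>
    exists_injective_range_eq (encard_of_mem_neighborhood hG (by simp) hT)
  have himage : ∀ T ∈ G.neighborhood {f u}, ∀ φ : Fin k → ι,
      f '' Set.range (fun j => g (e T j, φ j)) = T := fun T hT φ => by
    rw [← Set.range_comp]
    simpa [Function.comp_def, hfg] using hrange T hT
  have hcard : G.degree {f u} * Nat.card ι ^ k =
      (G.neighborhood {f u} ×ˢ (Set.univ : Set (Fin k → ι))).ncard := by
    rw [Set.ncard_prod, Set.ncard_univ, Nat.card_fun, Nat.card_fin, degree]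
  rw [hcard]
  refine Set.ncard_le_ncard_of_injOn (fun p => Set.range fun j => g (e p.1 j, p.2 j)) ?_ ?_
  · rintro ⟨T, φ⟩ ⟨hT, -⟩
    refine range_mem_neighborhood_blowup (heinj T hT) ?_ fun j => hfg _
    rwa [hrange T hT]
  · rintro ⟨T, φ⟩ ⟨hT, -⟩ ⟨T', φ'⟩ ⟨hT', -⟩ h
    obtain rfl : T = T' := by
      rw [← himage T hT φ, ← himage T' hT' φ']
      exact congrArg (f '' ·) h
    refine Prod.ext rfl (funext fun j => ?_)
    obtain ⟨j', hj'⟩ := h.le (Set.mem_range_self j)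
    obtain ⟨he, hφ⟩ := Prod.mk.injEq .. ▸ hg hj'
    rw [← hφ, heinj T hT he]

lemma minDegree_mul_pow_le_coveringThreshold [Finite α] [Nonempty α] {t N : ℕ} (ht : 0 < t)
    (hN : Nat.card α * t ≤ N) (hF : F.IsUniform (k + 1)) (hadj : V(F).Pairwise F.Adj)
    (hG : G.IsUniform (k + 1)) (hV : V(G) = Set.univ) (hc : ¬ HasCovering F G) :
    G.minDegree 1 * t ^ k ≤ coveringThreshold (k + 1) 1 N F := by
  have : Fintype α := Fintype.ofFinite α
  obtain ⟨g⟩ : Nonempty (α × Fin t ↪ Fin N) :=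
    Function.Embedding.nonempty_of_card_le (by simpa using hN)
  let f : Fin N → α := Function.extend g Prod.fst fun _ => Classical.arbitrary α
  have hfg : ∀ p, f (g p) = p.1 := g.injective.extend_apply _ _
  have hf : f.Surjective := fun x => ⟨g (x, ⟨0, ht⟩), hfg _⟩
  refine le_trans ?_ (minDegree_le_coveringThreshold rfl isUniform_blowup
    (not_hasCovering_blowup hF hadj hG hV hf hc))
  obtain ⟨w, -⟩ := hf (Classical.arbitrary α)
  refine le_minDegree_one ⟨w, Set.mem_univ w⟩ fun u _ => ?_
  calc G.minDegree 1 * t ^ k ≤ G.degree {f u} * Nat.card (Fin t) ^ k := by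
        rw [Nat.card_fin]
        exact Nat.mul_le_mul_right _ (minDegree_one_le_degree (hV ▸ Set.mem_univ _))
    _ ≤ (blowup (k + 1) G f).degree {u} :=
        degree_mul_pow_le_degree_blowup hG g.injective hfg u

lemma coveringThreshold_mul_pow_le (hF : F.IsUniform (k + 1)) (hadj : V(F).Pairwise F.Adj)
    {n N : ℕ} (hn : 0 < n) (hnN : n ≤ N) :
    coveringThreshold (k + 1) 1 n F * (N / n) ^ k ≤ coveringThreshold (k + 1) 1 N F := by
  have ht : 0 < N / n := Nat.div_pos hnN hn
  have : NeZero n := ⟨hn.ne'⟩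
  refine Nat.mul_le_of_le_div _ _ _ (coveringThreshold_le fun G hV hG hc => ?_)
  refine (Nat.le_div_iff_mul_le (pow_pos ht k)).2 ?_
  refine minDegree_mul_pow_le_coveringThreshold ht ?_ hF hadj hG hV hc
  simpa using Nat.mul_div_le N n

end Blowup

section Limit

variable {k : ℕ}

/-- Up to a factor tending to `1`, the quotient at any `n` bounds the quotients at all larger
indices from below, so the limit is the supremum. -/
lemma exists_tendsto_div_pow_of_mul_pow_le {c : ℕ → ℕ} (hle : ∀ n, c n ≤ n ^ k)
    (hmul : ∀ n N, 0 < n → n ≤ N → c n * (N / n) ^ k ≤ c N) :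
    ∃ L, Tendsto (fun n => (c n : ℝ) / (n : ℝ) ^ k) atTop (𝓝 L) := by
  let a : ℕ → ℝ := fun n => (c n : ℝ) / (n : ℝ) ^ k
  have hbdd : BddAbove (a '' Set.Ioi 0) := by
    refine ⟨1, ?_⟩
    rintro _ ⟨n, -, rfl⟩
    exact div_le_one_of_le₀ (mod_cast hle n) (by positivity)
  have hlower : ∀ n N, 0 < n → n ≤ N → a n * ((⌊(N : ℝ) / n⌋₊ : ℝ) / (N / n)) ^ k ≤ a N := by
    intro n N hn hnN
    have hN : 0 < N := hn.trans_le hnN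
    have h : (c n : ℝ) * ((N / n : ℕ) : ℝ) ^ k ≤ c N := mod_cast hmul n N hn hnN
    rw [Nat.floor_div_eq_div]
    calc (c n : ℝ) / n ^ k * ((N / n : ℕ) / (N / n : ℝ)) ^ k
        = c n * ((N / n : ℕ) : ℝ) ^ k / N ^ k := by simp only [div_pow]; field_simp
      _ ≤ c N / N ^ k := by gcongr
  refine ⟨sSup (a '' Set.Ioi 0), tendsto_order.2 ⟨fun b hb => ?_, fun b hb => ?_⟩⟩
  · obtain ⟨_, ⟨n, hn, rfl⟩, hbn⟩ := exists_lt_of_lt_csSup (Set.nonempty_Ioi.image a) hb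
    have hdiv : Tendsto (fun N : ℕ => (N : ℝ) / n) atTop atTop :=
      tendsto_natCast_atTop_atTop.atTop_div_const (Nat.cast_pos.2 hn)
    have hlim : Tendsto (fun N : ℕ => a n * ((⌊(N : ℝ) / n⌋₊ : ℝ) / (N / n)) ^ k) atTop
        (𝓝 (a n)) := by
      simpa using (((tendsto_nat_floor_div_atTop (R := ℝ)).comp hdiv).pow k).const_mul (a n)
    filter_upwards [hlim.eventually_const_lt hbn, eventually_ge_atTop n] with N hbN hnN
    exact hbN.trans_le (hlower n N hn hnN)
  · filter_upwards [eventually_gt_atTop 0] with N hN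
    exact (le_csSup hbdd ⟨N, hN, rfl⟩).trans_lt hb

lemma tendsto_pow_div_choose_pred (k : ℕ) :
    Tendsto (fun n : ℕ => (n : ℝ) ^ k / (n - 1).choose k) atTop (𝓝 k.factorial) := by
  rw [← tendsto_add_atTop_iff_nat 1]
  have hchoose : Tendsto (fun n : ℕ => (n : ℝ) ^ k / k.factorial / n.choose k) atTop (𝓝 1) := by
    refine (Asymptotics.isEquivalent_iff_tendsto_one ?_).1 (isEquivalent_choose k).symm
    filter_upwards [eventually_ge_atTop k] with n hn
    exact mod_cast (Nat.choose_pos hn).ne'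
  have hsucc : Tendsto (fun n : ℕ => ((1 + n : ℝ) / n) ^ k) atTop (𝓝 1) := by
    simpa using (tendsto_add_mul_div_add_mul_atTop_nhds (1 : ℝ) 0 1 one_ne_zero).pow k
  have h := (hsucc.mul hchoose).mul_const (k.factorial : ℝ)
  rw [one_mul, one_mul] at h
  refine h.congr' ?_
  filter_upwards [eventually_gt_atTop 0] with n hn
  simp only [Nat.add_sub_cancel]
  push_cast
  simp only [div_pow]
  field_simp
  ring

variable {γ : Type*} {F : Hypergraph γ}

theorem tendsto_coveringRatio (hF : F.IsUniform (k + 1)) (hadj : V(F).Pairwise F.Adj) :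
    Tendsto (coveringRatio (k + 1) 1 F) atTop (𝓝 (coveringDensity (k + 1) 1 F)) := by
  obtain ⟨L, hL⟩ := exists_tendsto_div_pow_of_mul_pow_le (fun _ => coveringThreshold_le_pow)
    fun n N => coveringThreshold_mul_pow_le hF hadj
  refine tendsto_nhds_limUnder
    ⟨L * k.factorial, (hL.mul (tendsto_pow_div_choose_pred k)).congr' ?_⟩
  filter_upwards [eventually_gt_atTop 0] with n hn
  rw [coveringRatio, div_mul_div_cancel₀ (by positivity), Nat.add_sub_cancel]

end Limit

section TightCycle

variable {r t : ℕ}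

lemma isUniform_tightCycle (h : r ≤ t) : (tightCycle r t).IsUniform r := by
  rintro _ ⟨i, rfl⟩
  rw [Set.InjOn.encard_image, ← Finset.coe_Iio, Set.encard_coe_eq_coe_finsetCard, Nat.card_Iio]
  intro j hj j' hj' hjj'
  have hmod := (ZMod.natCast_eq_natCast_iff' _ _ _).1 (add_left_cancel hjj')
  rwa [Nat.mod_eq_of_lt (hj.trans_le h), Nat.mod_eq_of_lt (hj'.trans_le h)] at hmod

lemma adj_tightCycle_add {j : ℕ} (hj : j < r) (x : ZMod t) : (tightCycle r t).Adj x (x + j) :=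
  ⟨_, ⟨x, rfl⟩, ⟨0, Nat.zero_lt_of_lt hj, by simp⟩, ⟨j, hj, rfl⟩⟩

lemma pairwise_adj_tightCycle (hrt : r ≤ t) (h : t < 2 * r) :
    V(tightCycle r t).Pairwise (tightCycle r t).Adj := by
  have : NeZero t := ⟨by omega⟩
  intro x _ y _ _
  have hcast : ((y - x).val : ZMod t) = y - x := ZMod.natCast_zmod_val _
  obtain hlt | hge := lt_or_ge (y - x).val r
  · simpa [hcast] using adj_tightCycle_add hlt x
  · have hlt : t - (y - x).val < r := by omega
    simpa [Nat.cast_sub (ZMod.val_lt _).le, hcast] using (adj_tightCycle_add hlt y).symm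

lemma mem_edgeSet_tightCycle_three {e : Set (ZMod t)} :
    e ∈ E(tightCycle 3 t) ↔ ∃ i, e = {i, i + 1, i + 2} := by
  have hIio : Set.Iio 3 = ({0, 1, 2} : Set ℕ) := by
    ext j
    simp only [Set.mem_Iio, Set.mem_insert_iff, Set.mem_singleton_iff]
    omega
  have himage (i : ZMod t) : (fun j : ℕ => i + (j : ZMod t)) '' Set.Iio 3 = {i, i + 1, i + 2} := by
    simp [hIio, Set.image_insert_eq]
  simp only [tightCycle, Set.mem_ofPred_eq, himage]

theorem tendsto_coveringRatio_tightCycle {k : ℕ} (ht : k + 1 ≤ t) (ht' : t < 2 * (k + 1)) :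
    Tendsto (coveringRatio (k + 1) 1 (tightCycle (k + 1) t)) atTop
      (𝓝 (coveringDensity (k + 1) 1 (tightCycle (k + 1) t))) :=
  tendsto_coveringRatio (isUniform_tightCycle ht) (pairwise_adj_tightCycle ht ht')

end TightCycle

section Multiplicity

open Finset

variable {α : Type*} [DecidableEq α]

lemma sum_sum_insert_insert {R : Type*} [CommSemiring R] {m : α → α → R}
    (hsymm : ∀ x y, m x y = m y x) (hdiag : ∀ x, m x x = 0) {r s : α} {T : Finset α}
    (hrs : r ≠ s) (hr : r ∉ T) (hs : s ∉ T) :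
    ∑ x ∈ insert r (insert s T), ∑ y ∈ insert r (insert s T), m x y =
      ∑ x ∈ T, ∑ y ∈ T, m x y + 2 * ∑ u ∈ T, (m u r + m u s) + 2 * m r s := by
  have hr' : r ∉ insert s T := by simp [hrs, hr]
  simp only [sum_insert hr', sum_insert hs, sum_add_distrib, hdiag]
  rw [hsymm s r, sum_congr rfl fun u _ => hsymm r u, sum_congr rfl fun u _ => hsymm s u]
  ring

/-- Delete pairs of multiplicity two that meet `A`, one after the other, until the pairs meeting
`A` have multiplicity at most one. -/
lemma sum_multiplicity_le {m : α → α → ℕ} (hsymm : ∀ x y, m x y = m y x)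
    (hdiag : ∀ x, m x x = 0) (hle : ∀ x y, m x y ≤ 2) {A : Finset α}
    (h3 : ∀ r ∈ A, ∀ s u, m r s = 2 → m u r + m u s ≤ 3)
    (h2 : ∀ r ∈ A, ∀ s u, m r s = 2 → s ∈ A ∨ u ∈ A → m u r + m u s ≤ 2) (S : Finset α) :
    ∑ x ∈ S, ∑ y ∈ S, m x y ≤ #S ^ 2 + #(S \ A) ^ 2 := by
  induction S using Finset.strongInduction with | H S ih
  by_cases hdouble : ∃ r ∈ A, ∃ s, r ∈ S ∧ s ∈ S ∧ m r s = 2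
  · obtain ⟨r, hrA, s, hrS, hsS, hm⟩ := hdouble
    have hrs : r ≠ s := by
      rintro rfl
      simp [hdiag] at hm
    obtain ⟨T, hr, hs, rfl⟩ : ∃ T, r ∉ T ∧ s ∉ T ∧ S = insert r (insert s T) :=
      ⟨(S.erase r).erase s, by simp, by simp,
        by rw [insert_erase (mem_erase.2 ⟨hrs.symm, hsS⟩), insert_erase hrS]⟩
    have hr' : r ∉ insert s T := by simp [hrs, hr]
    have ihT := ih T ⟨(subset_insert s T).trans (subset_insert r _), fun h => hr (h (by simp))⟩
    rw [sum_sum_insert_insert hsymm hdiag hrs hr hs, hm, card_insert_of_notMem hr',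
      card_insert_of_notMem hs, insert_sdiff_of_mem _ hrA]
    by_cases hsA : s ∈ A
    · have hT : ∑ u ∈ T, (m u r + m u s) ≤ #T * 2 :=
        sum_le_card_nsmul _ _ _ fun u _ => h2 r hrA s u hm (Or.inl hsA)
      rw [insert_sdiff_of_mem _ hsA]
      linarith
    · have hT : ∑ u ∈ T, (m u r + m u s) ≤ #T * 2 + #(T \ A) := by
        rw [sdiff_eq_filter, card_filter, ← smul_eq_mul, ← sum_const, ← sum_add_distrib]
        refine sum_le_sum fun u _ => ?_
        split_ifs with huA
        · exact h2 r hrA s u hm (Or.inr huA)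
        · exact h3 r hrA s u hm
      rw [insert_sdiff_of_notMem _ hsA, card_insert_of_notMem (by simp [hs])]
      linarith
  · have hone : ∀ r ∈ A, ∀ s, r ∈ S → s ∈ S → m r s ≤ 1 := fun r hrA s hrS hsS =>
      Nat.le_of_lt_succ ((hle r s).lt_of_ne fun h => hdouble ⟨r, hrA, s, hrS, hsS, h⟩)
    calc ∑ x ∈ S, ∑ y ∈ S, m x y
        ≤ ∑ x ∈ S, ∑ y ∈ S, (1 + (if x ∉ A then 1 else 0) * if y ∉ A then 1 else 0) := by
          refine sum_le_sum fun x hx => sum_le_sum fun y hy => ?_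
          by_cases hxA : x ∈ A
          · simpa [hxA] using hone x hxA y hx hy
          by_cases hyA : y ∈ A
          · simpa [hyA] using hsymm x y ▸ hone y hyA x hy hx
          · simpa [hxA, hyA] using hle x y
      _ = #S ^ 2 + #(S \ A) ^ 2 := by
          simp only [sum_add_distrib, sum_const, smul_eq_mul, mul_one, ← sum_mul_sum, sq,
            ← card_filter, sdiff_eq_filter]

end Multiplicity

section MixedTriangle

variable {α : Type*} {L M : SimpleGraph α}

/-- The vertex `q` lies in a triangle `q r s` whose edge `q r` is in `L`, whose edge `s q` is in
`M`, and whose edge `r s` is in both. For the links of two vertices `v` and `p` such that `v p q`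
is an edge, this closes up to the tight cycle `v r s p q`. -/
def HasMixedTriangleAt (L M : SimpleGraph α) (q : α) : Prop :=
  ∃ r s, L.Adj q r ∧ L.Adj r s ∧ M.Adj r s ∧ M.Adj s q

open Classical in
/-- The number of the two graphs `L` and `M` in which `x` and `y` are adjacent. -/
noncomputable def edgeMultiplicity (L M : SimpleGraph α) (x y : α) : ℕ :=
  (if L.Adj x y then 1 else 0) + (if M.Adj x y then 1 else 0)

lemma edgeMultiplicity_comm (x y : α) : edgeMultiplicity L M x y = edgeMultiplicity L M y x := by
  unfold edgeMultiplicity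
  congr 2 <;> exact propext (SimpleGraph.adj_comm _ x y)

lemma edgeMultiplicity_self (x : α) : edgeMultiplicity L M x x = 0 := by
  simp [edgeMultiplicity]

lemma edgeMultiplicity_le_two (x y : α) : edgeMultiplicity L M x y ≤ 2 := by
  unfold edgeMultiplicity
  split_ifs <;> simp

lemma edgeMultiplicity_eq_two_iff {x y : α} :
    edgeMultiplicity L M x y = 2 ↔ L.Adj x y ∧ M.Adj x y := by
  unfold edgeMultiplicity
  split_ifs <;> simp_all

lemma edgeMultiplicity_add_le_three {r s : α} (hrs : edgeMultiplicity L M r s = 2)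
    (hr : ¬ HasMixedTriangleAt L M r) (u : α) :
    edgeMultiplicity L M u r + edgeMultiplicity L M u s ≤ 3 := by
  have hlt : ¬ (edgeMultiplicity L M u r = 2 ∧ edgeMultiplicity L M u s = 2) := by
    simp only [edgeMultiplicity_eq_two_iff] at hrs ⊢
    exact fun ⟨hur, hus⟩ => hr ⟨s, u, hrs.1, hus.1.symm, hus.2.symm, hur.2⟩
  have := edgeMultiplicity_le_two (L := L) (M := M) u r
  have := edgeMultiplicity_le_two (L := L) (M := M) u s
  omega

lemma edgeMultiplicity_add_le_two_of_right {r s : α} (hrs : edgeMultiplicity L M r s = 2) {u : α}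
    (hu : ¬ HasMixedTriangleAt L M u) :
    edgeMultiplicity L M u r + edgeMultiplicity L M u s ≤ 2 := by
  rw [edgeMultiplicity_eq_two_iff] at hrs
  have hLM : ¬ (L.Adj u r ∧ M.Adj u s) := fun h => hu ⟨r, s, h.1, hrs.1, hrs.2, h.2.symm⟩
  have hML : ¬ (L.Adj u s ∧ M.Adj u r) := fun h =>
    hu ⟨s, r, h.1, hrs.1.symm, hrs.2.symm, h.2.symm⟩
  unfold edgeMultiplicity
  grind

lemma edgeMultiplicity_add_le_two_of_left {r s : α} (hrs : edgeMultiplicity L M r s = 2)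
    (hr : ¬ HasMixedTriangleAt L M r) (hs : ¬ HasMixedTriangleAt L M s) (u : α) :
    edgeMultiplicity L M u r + edgeMultiplicity L M u s ≤ 2 := by
  rw [edgeMultiplicity_eq_two_iff] at hrs
  have hrM : ¬ (L.Adj u s ∧ M.Adj u s ∧ M.Adj u r) := fun h =>
    hr ⟨s, u, hrs.1, h.1.symm, h.2.1.symm, h.2.2⟩
  have hrL : ¬ (L.Adj u s ∧ M.Adj u s ∧ L.Adj u r) := fun h =>
    hr ⟨u, s, h.2.2.symm, h.1, h.2.1, hrs.2.symm⟩
  have hsM : ¬ (L.Adj u r ∧ M.Adj u r ∧ M.Adj u s) := fun h =>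
    hs ⟨r, u, hrs.1.symm, h.1.symm, h.2.1.symm, h.2.2⟩
  have hsL : ¬ (L.Adj u r ∧ M.Adj u r ∧ L.Adj u s) := fun h =>
    hs ⟨u, r, h.2.2.symm, h.1, h.2.1, hrs.2⟩
  unfold edgeMultiplicity
  grind

open Finset Classical in
theorem sum_degree_add_sum_degree_le [Fintype α] {A : Finset α}
    (hA : ∀ q ∈ A, ¬ HasMixedTriangleAt L M q) :
    ∑ x, L.degree x + ∑ x, M.degree x ≤ Fintype.card α ^ 2 + #Aᶜ ^ 2 := by
  have hdeg (H : SimpleGraph α) (x : α) : H.degree x = ∑ y, if H.Adj x y then 1 else 0 := by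
    rw [← H.card_neighborFinset_eq_degree, H.neighborFinset_eq_filter, card_filter]
  calc ∑ x, L.degree x + ∑ x, M.degree x = ∑ x, ∑ y, edgeMultiplicity L M x y := by
        simp only [hdeg, edgeMultiplicity, sum_add_distrib]
    _ ≤ Fintype.card α ^ 2 + #Aᶜ ^ 2 := by
        refine sum_multiplicity_le edgeMultiplicity_comm edgeMultiplicity_self
          edgeMultiplicity_le_two (fun r hr s u hrs => ?_) (fun r hr s u hrs h => ?_) univ
        · exact edgeMultiplicity_add_le_three hrs (hA r hr) u
        · obtain hs | hu := h
          · exact edgeMultiplicity_add_le_two_of_left hrs (hA r hr) (hA s hs) u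
          · exact edgeMultiplicity_add_le_two_of_right hrs (hA u hu)

end MixedTriangle

section Link

variable {α : Type*} {G : Hypergraph α}

lemma encard_triple_eq_three {x y z : α} :
    ({x, y, z} : Set α).encard = 3 ↔ x ≠ y ∧ x ≠ z ∧ y ≠ z := by
  classical
  have h : ({x, y, z} : Set α) = ({x, y, z} : Finset α) := by simp
  rw [h, Set.encard_coe_eq_coe_finsetCard]
  exact_mod_cast Finset.card_triple_eq_three_iff

/-- The link of a vertex `u` of a `3`-graph, as a graph on the same vertices; it includes `u`
itself as an isolated vertex. -/
def link (hG : G.IsUniform 3) (u : α) : SimpleGraph α where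
  Adj x y := {u, x, y} ∈ E(G)
  symm := ⟨fun x y h => by rwa [Set.pair_comm]⟩
  loopless := ⟨fun x h => (encard_triple_eq_three.1 (hG _ h)).2.2 rfl⟩

lemma neighborhood_singleton (hG : G.IsUniform 3) (u : α) :
    G.neighborhood {u} = (fun e : Sym2 α => (e : Set α)) '' (link hG u).edgeSet := by
  ext T
  constructor
  · intro hT
    obtain ⟨x, y, -, rfl⟩ := Set.encard_eq_two.1
      (encard_of_mem_neighborhood (k := 2) (i := 1) hG (by simp) hT)
    have hedge : {u} ∪ {x, y} ∈ E(G) := hT.2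
    exact ⟨s(x, y), by rwa [Set.singleton_union] at hedge, Sym2.coe_mk⟩
  · rintro ⟨e, he, rfl⟩
    induction e with | h x y
    have hedge : {u, x, y} ∈ E(G) := he
    have hne := encard_triple_eq_three.1 (hG _ hedge)
    exact ⟨by simp [hne.1, hne.2.1], by rwa [← Set.singleton_union, ← Sym2.coe_mk] at hedge⟩

lemma two_mul_degree_singleton [Fintype α] (hG : G.IsUniform 3) (u : α)
    [DecidableRel (link hG u).Adj] : 2 * G.degree {u} = ∑ x, (link hG u).degree x := by
  classical
  rw [SimpleGraph.sum_degrees_eq_twice_card_edges, degree, neighborhood_singleton hG,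
    Set.ncard_image_of_injective _ SetLike.coe_injective, Set.ncard_eq_toFinset_card',
    SimpleGraph.edgeFinset]

end Link


section UpperBound

variable {α : Type*} {G : Hypergraph α}

lemma exists_isCopy_tightCycle (hV : V(G) = Set.univ) (hG : G.IsUniform 3) {v p q : α}
    (hpq : (link hG v).Adj p q) (hq : HasMixedTriangleAt (link hG v) (link hG p) q) :
    ∃ f, IsCopy (tightCycle 3 5) G f ∧ v ∈ f '' V(tightCycle 3 5) := by
  obtain ⟨r, s, hqr, hrs, hrs', hsq⟩ := hq
  let f : ZMod 5 → α := (![v, r, s, p, q] : Fin 5 → α)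
  refine ⟨f, isCopy_of_image_mem_edgeSet (isUniform_tightCycle (by norm_num))
    (pairwise_adj_tightCycle (by norm_num) (by norm_num)) hG hV fun e he => ?_, 0, trivial, rfl⟩
  obtain ⟨i, rfl⟩ := mem_edgeSet_tightCycle_three.1 he
  rw [Set.image_insert_eq, Set.image_pair]
  change Fin 5 at i
  fin_cases i
  · exact hrs
  · change {r, s, p} ∈ E(G)
    rwa [Set.pair_comm, Set.insert_comm]
  · change {s, p, q} ∈ E(G)
    rwa [Set.insert_comm]
  · change {p, q, v} ∈ E(G)
    rwa [Set.pair_comm, Set.insert_comm]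
  · change {q, v, r} ∈ E(G)
    rwa [Set.insert_comm]

lemma exists_minDegree_le_of_not_hasCovering [Fintype α] (hV : V(G) = Set.univ)
    (hG : G.IsUniform 3) (hc : ¬ HasCovering (tightCycle 3 5) G) :
    ∃ a ≤ Fintype.card α, 2 * G.minDegree 1 ≤ Fintype.card α * a ∧
      4 * G.minDegree 1 ≤ Fintype.card α ^ 2 + (Fintype.card α - a) ^ 2 := by
  classical
  obtain ⟨v, -, hv⟩ := not_hasCovering_iff.1 hc
  have hdeg (u : α) : 2 * G.minDegree 1 ≤ ∑ x, (link hG u).degree x :=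
    two_mul_degree_singleton hG u ▸
      Nat.mul_le_mul_left 2 (minDegree_one_le_degree (hV ▸ Set.mem_univ u))
  obtain ⟨p, -, hp⟩ := Finset.exists_max_image Finset.univ (fun x => (link hG v).degree x)
    ⟨v, Finset.mem_univ v⟩
  let A := (link hG v).neighborFinset p
  have hA : ∀ q ∈ A, ¬ HasMixedTriangleAt (link hG v) (link hG p) q := fun q hq hmix => by
    obtain ⟨f, hf, hvf⟩ := exists_isCopy_tightCycle hV hG
      ((SimpleGraph.mem_neighborFinset _ p q).1 hq) hmix
    exact hv f hf hvf
  refine ⟨A.card, Finset.card_le_univ A, (hdeg v).trans ?_, ?_⟩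
  · simpa [A] using Finset.sum_le_card_nsmul _ _ _ hp
  · have := sum_degree_add_sum_degree_le hA
    rw [Finset.card_compl] at this
    linarith [hdeg v, hdeg p]

lemma two_mul_le_two_sub_sqrt_two_mul_sq {d n a : ℝ} (hn : 0 ≤ n) (han : a ≤ n)
    (h : 2 * d ≤ n * a) (h' : 4 * d ≤ n ^ 2 + (n - a) ^ 2) : 2 * d ≤ (2 - √2) * n ^ 2 := by
  have hsq : √2 ^ 2 = 2 := Real.sq_sqrt (by norm_num)
  obtain hle | hlt := le_total a ((2 - √2) * n)
  · nlinarith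
  · have : 0 ≤ √2 := Real.sqrt_nonneg 2
    have hb : n - a ≤ (√2 - 1) * n := by linarith
    have hb' : (n - a) ^ 2 ≤ ((√2 - 1) * n) ^ 2 := pow_le_pow_left₀ (by linarith) hb 2
    nlinarith

lemma two_mul_coveringThreshold_tightCycle_le (n : ℕ) :
    2 * (coveringThreshold 3 1 n (tightCycle 3 5) : ℝ) ≤ (2 - √2) * n ^ 2 := by
  have hle : coveringThreshold 3 1 n (tightCycle 3 5) ≤ ⌊(2 - √2) * (n : ℝ) ^ 2 / 2⌋₊ :=
    coveringThreshold_le fun G hV hG hc => Nat.le_floor <| by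
      obtain ⟨a, han, h, h'⟩ := exists_minDegree_le_of_not_hasCovering hV hG hc
      rw [Fintype.card_fin] at han h h'
      rw [le_div_iff₀' two_pos]
      refine two_mul_le_two_sub_sqrt_two_mul_sq (Nat.cast_nonneg n) (Nat.cast_le.2 han)
        (by exact_mod_cast h) ?_
      rw [← Nat.cast_sub han]
      exact_mod_cast h'
  have hsqrt : √2 ≤ 2 := Real.sqrt_le_iff.2 (by norm_num)
  have := (Nat.le_floor_iff (by positivity)).1 hle
  linarith

theorem coveringDensity_tightCycle_le :
    coveringDensity 3 1 (tightCycle 3 5) ≤ 2 - √2 := by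
  refine le_of_tendsto_of_tendsto
    (tendsto_coveringRatio_tightCycle (k := 2) (by norm_num) (by norm_num)) (b := atTop)
    (g := fun n : ℕ => (2 - √2) / 2 * ((n : ℝ) ^ 2 / (n - 1).choose 2)) ?_
    (Eventually.of_forall fun n => ?_)
  · simpa using (tendsto_pow_div_choose_pred 2).const_mul ((2 - √2) / 2)
  · dsimp only
    rw [← mul_div_assoc]
    refine div_le_div_of_nonneg_right ?_ (Nat.cast_nonneg _)
    linarith [two_mul_coveringThreshold_tightCycle_le n]

end UpperBound

section LowerBound

variable {α : Type*} {v : α} {A : Set α}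

/-- The extremal `3`-graph of the lower bound: the vertices other than `v` are coloured according
to membership in `A`, and the edges are the triples through `v` whose other two vertices have the
same colour, and the triples avoiding `v` that are not monochromatic. -/
def apexGraph (v : α) (A : Set α) : Hypergraph α where
  vertexSet := Set.univ
  edgeSet := {e | e.encard = 3 ∧
    (v ∈ e ↔ ∀ x ∈ e \ {v}, ∀ y ∈ e \ {v}, (x ∈ A ↔ y ∈ A))}
  subset_vertexSet_of_mem_edgeSet' := fun _ _ => Set.subset_univ _

lemma isUniform_apexGraph : (apexGraph v A).IsUniform 3 := fun _ he => he.1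

lemma apex_mem_edgeSet_apexGraph {x y : α} :
    {v, x, y} ∈ E(apexGraph v A) ↔ (v ≠ x ∧ v ≠ y ∧ x ≠ y) ∧ (x ∈ A ↔ y ∈ A) := by
  change _ ∧ _ ↔ _
  rw [encard_triple_eq_three]
  refine and_congr_right ?_
  rintro ⟨hx, hy, -⟩
  have hdiff : ({v, x, y} : Set α) \ {v} = {x, y} :=
    Set.insert_sdiff_self_of_notMem (by simp [hx, hy])
  simp only [hdiff, Set.mem_insert_iff, Set.mem_singleton_iff, forall_eq_or_imp, forall_eq]
  tauto

lemma mem_edgeSet_apexGraph {x y z : α} (hx : x ≠ v) (hy : y ≠ v) (hz : z ≠ v) :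
    {x, y, z} ∈ E(apexGraph v A) ↔
      (x ≠ y ∧ x ≠ z ∧ y ≠ z) ∧ ¬ ((x ∈ A ↔ y ∈ A) ∧ (x ∈ A ↔ z ∈ A)) := by
  change _ ∧ _ ↔ _
  rw [encard_triple_eq_three]
  refine and_congr_right fun _ => ?_
  have hv : v ∉ ({x, y, z} : Set α) := by simp [hx.symm, hy.symm, hz.symm]
  simp only [Set.sdiff_singleton_eq_self hv, hv, Set.mem_insert_iff, Set.mem_singleton_iff,
    forall_eq_or_imp, forall_eq]
  tauto

theorem not_hasCovering_apexGraph : ¬ HasCovering (tightCycle 3 5) (apexGraph v A) := by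
  refine not_hasCovering_iff.2 ⟨v, trivial, ?_⟩
  rintro f hf ⟨i, -, hi⟩
  have hedge (a b c : ZMod 5) (hb : a + 1 = b) (hc : a + 2 = c) :
      {f (i + a), f (i + b), f (i + c)} ∈ E(apexGraph v A) := by
    have := hf.2.2 _ (mem_edgeSet_tightCycle_three.2 ⟨i + a, rfl⟩)
    rwa [Set.image_insert_eq, Set.image_pair, add_assoc, add_assoc, hb, hc] at this
  have h012 := hedge 0 1 2 rfl rfl
  have h123 := hedge 1 2 3 rfl rfl
  have h340 := hedge 3 4 0 rfl rfl
  have h401 := hedge 4 0 1 rfl rfl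
  rw [add_zero, hi] at h012 h340 h401
  rw [apex_mem_edgeSet_apexGraph] at h012
  rw [Set.pair_comm, Set.insert_comm, apex_mem_edgeSet_apexGraph] at h340
  rw [Set.insert_comm, apex_mem_edgeSet_apexGraph] at h401
  rw [mem_edgeSet_apexGraph h012.1.1.symm h012.1.2.1.symm h340.1.1.symm] at h123
  tauto

section Degree

open Finset

variable {S T : Finset α}

lemma card_mul_add_card_mul_le_sum [Fintype α] {f : α → ℕ} {a b : ℕ} (hST : Disjoint S T)
    (ha : ∀ x ∈ S, a ≤ f x) (hb : ∀ x ∈ T, b ≤ f x) : #S * a + #T * b ≤ ∑ x, f x := by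
  classical
  calc #S * a + #T * b ≤ ∑ x ∈ S, f x + ∑ x ∈ T, f x :=
        add_le_add (card_nsmul_le_sum _ _ _ ha) (card_nsmul_le_sum _ _ _ hb)
    _ = ∑ x ∈ S ∪ T, f x := (sum_union hST).symm
    _ ≤ ∑ x, f x := sum_le_univ_sum_of_nonneg fun _ => Nat.zero_le _

lemma le_two_mul_degree_apexGraph_apex [Finite α] (hS : ∀ x ∈ S, x ≠ v ∧ x ∈ A)
    (hT : ∀ x ∈ T, x ≠ v ∧ x ∉ A) :
    #S * (#S - 1) + #T * (#T - 1) ≤ 2 * (apexGraph v A).degree {v} := by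
  classical
  have := Fintype.ofFinite α
  rw [two_mul_degree_singleton isUniform_apexGraph]
  refine card_mul_add_card_mul_le_sum
    (disjoint_left.2 fun x hxS hxT => (hT x hxT).2 (hS x hxS).2) (fun x hx => ?_) fun x hx => ?_
  · rw [← card_erase_of_mem hx, ← SimpleGraph.card_neighborFinset_eq_degree]
    refine card_le_card fun y hy => (SimpleGraph.mem_neighborFinset _ x y).2
      (apex_mem_edgeSet_apexGraph.2 ?_)
    grind
  · rw [← card_erase_of_mem hx, ← SimpleGraph.card_neighborFinset_eq_degree]
    refine card_le_card fun y hy => (SimpleGraph.mem_neighborFinset _ x y).2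
      (apex_mem_edgeSet_apexGraph.2 ?_)
    grind

lemma le_two_mul_degree_apexGraph [Finite α] {u : α} (hu : u ≠ v)
    (hS : ∀ x ∈ S, x ≠ v ∧ x ≠ u ∧ (x ∈ A ↔ u ∈ A))
    (hT : ∀ x ∈ T, x ≠ v ∧ ¬ (x ∈ A ↔ u ∈ A)) :
    #S * #T + #T * (#S + #T - 1) ≤ 2 * (apexGraph v A).degree {u} := by
  classical
  have := Fintype.ofFinite α
  have hST : Disjoint S T := disjoint_left.2 fun x hxS hxT => (hT x hxT).2 (hS x hxS).2.2
  rw [two_mul_degree_singleton isUniform_apexGraph]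
  refine card_mul_add_card_mul_le_sum hST (fun x hx => ?_) fun x hx => ?_
  · rw [← SimpleGraph.card_neighborFinset_eq_degree]
    refine card_le_card fun y hy => (SimpleGraph.mem_neighborFinset _ x y).2
      ((mem_edgeSet_apexGraph hu (hS x hx).1 (hT y hy).1).2 ?_)
    grind
  · rw [← card_union_of_disjoint hST, ← card_erase_of_mem (mem_union_right S hx),
      ← SimpleGraph.card_neighborFinset_eq_degree]
    refine card_le_card fun y hy => (SimpleGraph.mem_neighborFinset _ x y).2
      ((mem_edgeSet_apexGraph hu (hT x hx).1 ?_).2 ?_) <;> grind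

end Degree

lemma five_mul_sq_le_two_mul_degree_apexGraph [Finite α] {A B : Finset α} {m : ℕ}
    (hA : A.card = 2 * m) (hB : B.card = m) (hAB : Disjoint A B) (hvA : v ∉ A) (hvB : v ∉ B)
    (hcover : ∀ u, u = v ∨ u ∈ A ∨ u ∈ B) (u : α) :
    5 * m ^ 2 ≤ 2 * (apexGraph v (A : Set α)).degree {u} + 3 * m := by
  classical
  have hBA : ∀ x ∈ B, x ∉ A := fun x hxB hxA => Finset.disjoint_left.1 hAB hxA hxB
  obtain rfl | ⟨k, rfl⟩ : m = 0 ∨ ∃ k, m = k + 1 := by cases m <;> simp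
  · simp
  obtain rfl | hu | hu := hcover u
  · have := le_two_mul_degree_apexGraph_apex (v := u) (A := A) (S := A) (T := B)
      (by grind) (by grind)
    rw [hA, hB, show 2 * (k + 1) - 1 = 2 * k + 1 by omega, Nat.add_sub_cancel] at this
    linarith
  · have := le_two_mul_degree_apexGraph (v := v) (A := A) (u := u) (S := A.erase u) (T := B)
      (by grind) (by grind) (by grind)
    rw [Finset.card_erase_of_mem hu, hA, hB, show 2 * (k + 1) - 1 = 2 * k + 1 by omega,
      ← add_assoc, Nat.add_sub_cancel] at this
    linarith
  · have := le_two_mul_degree_apexGraph (v := v) (A := A) (u := u) (S := B.erase u) (T := A)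
      (by grind) (by grind) (by grind)
    rw [Finset.card_erase_of_mem hu, hA, hB, Nat.add_sub_cancel,
      show k + 2 * (k + 1) - 1 = 3 * k + 1 by omega] at this
    nlinarith

lemma five_mul_sq_le_two_mul_coveringThreshold_tightCycle (m : ℕ) :
    5 * m ^ 2 ≤ 2 * coveringThreshold 3 1 (3 * m + 1) (tightCycle 3 5) + 3 * m := by
  have hcard : (Finset.univ.erase (0 : Fin (3 * m + 1))).card = 3 * m := by simp
  obtain ⟨A, hsub, hA⟩ := Finset.exists_subset_card_eq (n := 2 * m)
    (s := Finset.univ.erase (0 : Fin (3 * m + 1))) (by omega)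
  have hB : (Finset.univ.erase 0 \ A).card = m := by
    rw [Finset.card_sdiff_of_subset hsub, hcard, hA]
    omega
  have hdeg := five_mul_sq_le_two_mul_degree_apexGraph hA hB Finset.disjoint_sdiff
    (v := 0) (by grind) (by grind) (by grind)
  have hmin : (5 * m ^ 2 - 3 * m + 1) / 2 ≤
      (apexGraph 0 (A : Set (Fin (3 * m + 1)))).minDegree 1 :=
    le_minDegree_one Set.univ_nonempty fun u _ => by have := hdeg u; omega
  have := hmin.trans (minDegree_le_coveringThreshold rfl isUniform_apexGraph
    not_hasCovering_apexGraph)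
  omega

theorem le_coveringDensity_tightCycle : 5 / 9 ≤ coveringDensity 3 1 (tightCycle 3 5) := by
  have hsubseq : Tendsto (fun m : ℕ => 3 * m + 1) atTop atTop :=
    tendsto_atTop_mono (fun m => (by omega : m ≤ 3 * m + 1)) tendsto_id
  refine le_of_tendsto_of_tendsto
    (tendsto_add_mul_div_add_mul_atTop_nhds (-3 : ℝ) (-3) 5 (by norm_num : (9 : ℝ) ≠ 0))
    ((tendsto_coveringRatio_tightCycle (k := 2) (by norm_num) (by norm_num)).comp hsubseq) ?_
  filter_upwards [eventually_gt_atTop 0] with m hm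
  have hm1 : (1 : ℝ) ≤ m := Nat.one_le_cast.2 hm
  have hc : 5 * (m : ℝ) ^ 2 ≤
      2 * coveringThreshold 3 1 (3 * m + 1) (tightCycle 3 5) + 3 * m := by
    exact_mod_cast five_mul_sq_le_two_mul_coveringThreshold_tightCycle m
  rw [Function.comp_apply, coveringRatio, Nat.add_sub_cancel, Nat.cast_choose_two, Nat.cast_mul,
    Nat.cast_ofNat, div_le_div_iff₀ (by linarith) (by nlinarith)]
  nlinarith

end LowerBound

end HypergraphCovering

theorem mainTheorem7 :
    Tendsto (Hypergraph.coveringRatio 3 1 (Hypergraph.tightCycle 3 5)) atTop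
      (𝓝 (Hypergraph.coveringDensity 3 1 (Hypergraph.tightCycle 3 5))) ∧
    (5 / 9 : ℝ) ≤ Hypergraph.coveringDensity 3 1 (Hypergraph.tightCycle 3 5) ∧
    Hypergraph.coveringDensity 3 1 (Hypergraph.tightCycle 3 5) ≤ 2 - Real.sqrt 2 :=
  ⟨HypergraphCovering.tendsto_coveringRatio_tightCycle (by norm_num) (by norm_num),
    HypergraphCovering.le_coveringDensity_tightCycle,
    HypergraphCovering.coveringDensity_tightCycle_le⟩
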